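/- Let $q$ be a prime power, let $n\ge 6$, and let $V$ be an $n$-dimensional vector space over the field $\mathbb F_q$ with $q$ elements. Write ${n\brack k}_q=\prod_{i=0}^{k-1}\frac{q^{n-i}-1}{q^{k-i}-1}$ for the Gaussian binomial coefficient. For a family $\mathcal G$ of $3$-dimensional subspaces of $V$, let $\mathcal I(\mathcal G)=\sum_{A\in\mathcal G}\sum_{B\in\mathcal G}\dim(A\cap B)$ be its total intersection number, and for such a family $\mathcal F$ let $\mathcal{MI}(\mathcal F)$ be the maximum of $\mathcal I(\mathcal G)$ over all families $\mathcal G$ of $3$-dimensional subspaces of $V$ with $|\mathcal G|=|\mathcal F|$. Let $\mathcal F$ be a family of $3$-dimensional subspaces of $V$ with $|\mathcal F|={n-2\brack 1}_q$. Then $$\mathcal{MI}(\mathcal F)=\frac{(2q^{n-2}+q-3)(q^{n-2}-1)}{(q-1)^2}.$$ Moreover, the maximum is attained by every full $2$-star: for every $2$-dimensional subspace $U$ of $V$, the family $\mathcal Y_U$ of all $3$-dimensional subspaces of $V$ containing $U$ satisfies $|\mathcal Y_U|=|\mathcal F|$ and $\mathcal I(\mathcal Y_U)=\mathcal{MI}(\mathcal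 F)$. Consequently the second linear programming bound $$\mathcal{MI}(\mathcal F)\le\left[\frac{{n\brack k}_q}{M}-\frac{(q^n-1)(q^{n-1}-1)}{(q-1)(q^k-1)}\right]\frac{M^2(q^k-1)(q^{k-1}-1)(q^{n-k}-1)}{(q^n-1)(q^{n-1}-1)(q^{n-2}-1)}+kM^2,$$ which is stated for families of $M$ subspaces of dimension $k$ with $n\ge 2k$ and $M\le{n-1\brack k-1}_q$, is tight: for $k=3$ and $M=|\mathcal F|={n-2\brack 1}_q$ one has $M\le{n-1\brack 2}_q$, and equality holds in the bound. -/

import Mathlib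

/-- The set of all `k`-dimensional subspaces of the `K`-vector space `V`. -/
def Grass (K V : Type*) [Field K] [AddCommGroup V] [Module K V] (k : ℕ) : Type _ :=
  {W : Submodule K V // Module.finrank K W = k}

/-- A finite-dimensional space over a finite field has finitely many `k`-dimensional subspaces. -/
noncomputable instance Grass.instFintype (K V : Type*) [Field K] [Finite K] [AddCommGroup V]
    [Module K V] [FiniteDimensional K V] (k : ℕ) : Fintype (Grass K V k) :=
  haveI : Finite V := Module.finite_of_finite K
  haveI : Finite (Grass K V k) := Subtype.finite
  Fintype.ofFinite _

/-- The Gaussian binomial coefficient `∏_{i < k} (q ^ (n - i) - 1) / (q ^ (k - i) - 1)`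
(for `k ≤ n`). -/
def gaussBinom (q n k : ℕ) : ℚ :=
  ∏ i ∈ Finset.range k, ((q : ℚ) ^ (n - i) - 1) / ((q : ℚ) ^ (k - i) - 1)

/-- `int(A, B) = dim (A ∩ B)`. -/
noncomputable def interDim {K V : Type*} [Field K] [AddCommGroup V] [Module K V] {k : ℕ}
    (A B : Grass K V k) : ℕ :=
  Module.finrank K (A.1 ⊓ B.1 : Submodule K V)

/-- The total intersection number of a family `F`, the sum over ordered pairs (the pairs
`(A, A)` included). -/
noncomputable def totalInter {K V : Type*} [Field K] [AddCommGroup V] [Module K V] {k : ℕ}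
    (F : Finset (Grass K V k)) : ℕ :=
  ∑ A ∈ F, ∑ B ∈ F, interDim A B

/-- The maximum of the total intersection number over all families of `k`-dimensional subspaces
of `V` with as many members as `F`. -/
noncomputable def maxTotalInter {K V : Type*} [Field K] [Finite K] [AddCommGroup V] [Module K V]
    [FiniteDimensional K V] {k : ℕ} (F : Finset (Grass K V k)) : ℕ :=
  (Finset.univ.powersetCard F.card).sup'
    ⟨F, Finset.mem_powersetCard.2 ⟨Finset.subset_univ F, rfl⟩⟩ totalInter

open Classical in
/-- The full star at `U`: all `k`-dimensional subspaces of `V` that contain `U`. -/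
noncomputable def fullStar {K V : Type*} [Field K] [Finite K] [AddCommGroup V] [Module K V]
    [FiniteDimensional K V] (k : ℕ) (U : Submodule K V) : Finset (Grass K V k) :=
  Finset.univ.filter fun W => U ≤ W.1

/-- The second linear programming bound, on families of `M` subspaces of dimension `k`; it is
formulated for `2 * k ≤ n` and `M ≤ gaussBinom q (n - 1) (k - 1)`. -/
def secondLPBound (q n k : ℕ) (M : ℚ) : ℚ :=
  (gaussBinom q n k / M
      - ((q : ℚ) ^ n - 1) * ((q : ℚ) ^ (n - 1) - 1) / (((q : ℚ) - 1) * ((q : ℚ) ^ k - 1)))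
    * (M ^ 2 * ((q : ℚ) ^ k - 1) * ((q : ℚ) ^ (k - 1) - 1) * ((q : ℚ) ^ (n - k) - 1)
      / (((q : ℚ) ^ n - 1) * ((q : ℚ) ^ (n - 1) - 1) * ((q : ℚ) ^ (n - 2) - 1)))
    + k * M ^ 2

/-!
Write `[n, k]` for the Gaussian binomial coefficient. Two distinct `(k + 1)`-spaces meet in
dimension at most `k`, so `M` of them have total intersection number at most `M (k M + 1)`.
Equality holds as soon as all of them contain a common `k`-space `U`, so the full star at `U`
attains the maximum among families of its size. By the correspondence theorem its members are
the points of the projective space of `V ⧸ U`, hence `M = [n - k, 1]`. For `k = 2` the maximum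
is `M (2 M + 1)`. In the linear programming bound,
`[n, 3] / M = (q ^ n - 1) (q ^ (n - 1) - 1) / ((q ^ 3 - 1) (q ^ 2 - 1))`; since
`M - 1 = q [n - 3, 1]`, the first summand becomes `-M (M - 1)`, and `3 M ^ 2 - M (M - 1)` is
again `M (2 M + 1)`.
-/

open Finset Module

section GaussianBinomial

theorem pow_sub_one_pos {R : Type*} [Ring R] [LinearOrder R] [IsStrictOrderedRing R] {a : R}
    (ha : 1 < a) {m : ℕ} (hm : m ≠ 0) : 0 < a ^ m - 1 :=
  sub_pos.2 (one_lt_pow₀ ha hm)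

theorem gaussBinom_one (q n : ℕ) : gaussBinom q n 1 = ((q : ℚ) ^ n - 1) / ((q : ℚ) - 1) := by
  simp [gaussBinom]

theorem gaussBinom_one_eq_geom_sum {q : ℕ} (hq : q ≠ 1) (n : ℕ) :
    gaussBinom q n 1 = ∑ i ∈ range n, (q : ℚ) ^ i := by
  rw [gaussBinom_one, geom_sum_eq (mod_cast hq)]

theorem gaussBinom_succ_one {q : ℕ} (hq : q ≠ 1) (n : ℕ) :
    gaussBinom q (n + 1) 1 = q * gaussBinom q n 1 + 1 := by
  simp only [gaussBinom_one_eq_geom_sum hq, geom_sum_succ]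

theorem gaussBinom_succ_succ (q n k : ℕ) :
    gaussBinom q (n + 1) (k + 1) =
      ((q : ℚ) ^ (n + 1) - 1) / ((q : ℚ) ^ (k + 1) - 1) * gaussBinom q n k := by
  simp only [gaussBinom, prod_range_succ', Nat.add_sub_add_right, Nat.sub_zero]
  exact mul_comm _ _

theorem gaussBinom_pos {q n k : ℕ} (hq : 1 < q) (hk : k ≤ n) : 0 < gaussBinom q n k := by
  have hq' : (1 : ℚ) < q := mod_cast hq
  refine prod_pos fun i hi => ?_
  have hik : i < k := mem_range.1 hi
  exact div_pos (pow_sub_one_pos hq' (by lia)) (pow_sub_one_pos hq' (by lia))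

theorem gaussBinom_le_gaussBinom_succ_succ {q n k : ℕ} (hq : 1 < q) (hk : k ≤ n) :
    gaussBinom q n k ≤ gaussBinom q (n + 1) (k + 1) := by
  have hq' : (1 : ℚ) < q := mod_cast hq
  have hratio : 1 ≤ ((q : ℚ) ^ (n + 1) - 1) / ((q : ℚ) ^ (k + 1) - 1) := by
    rw [one_le_div (pow_sub_one_pos hq' k.succ_ne_zero)]
    exact sub_le_sub_right (pow_le_pow_right₀ hq'.le (by lia)) 1
  rw [gaussBinom_succ_succ]
  exact le_mul_of_one_le_left (gaussBinom_pos hq hk).le hratio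

theorem gaussBinom_add_two_div_gaussBinom {q n k : ℕ} (hq : 1 < q) (hk : k ≤ n) :
    gaussBinom q (n + 2) (k + 2) / gaussBinom q n k =
      ((q : ℚ) ^ (n + 2) - 1) * ((q : ℚ) ^ (n + 1) - 1) /
        (((q : ℚ) ^ (k + 2) - 1) * ((q : ℚ) ^ (k + 1) - 1)) := by
  rw [gaussBinom_succ_succ, gaussBinom_succ_succ, ← mul_assoc,
    mul_div_cancel_right₀ _ (gaussBinom_pos hq hk).ne', div_mul_div_comm]

theorem secondLPBound_three_gaussBinom {q : ℕ} (hq : 1 < q) (n : ℕ) :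
    secondLPBound q (n + 3) 3 (gaussBinom q (n + 1) 1) =
      gaussBinom q (n + 1) 1 * (2 * gaussBinom q (n + 1) 1 + 1) := by
  have hpow {m : ℕ} (hm : m ≠ 0) : (q : ℚ) ^ m - 1 ≠ 0 := (pow_sub_one_pos (mod_cast hq) hm).ne'
  have hq₁ : (q : ℚ) - 1 ≠ 0 := by simpa using hpow one_ne_zero
  have hq₂ := hpow two_ne_zero
  have hq₃ := hpow three_ne_zero
  have hn₁ := hpow n.succ_ne_zero
  have hn₂ := hpow (n + 1).succ_ne_zero
  have hn₃ := hpow (n + 2).succ_ne_zero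
  set M := gaussBinom q (n + 1) 1 with hM
  have hbracket : gaussBinom q (n + 3) 3 / M -
      ((q : ℚ) ^ (n + 3) - 1) * ((q : ℚ) ^ (n + 2) - 1) / (((q : ℚ) - 1) * ((q : ℚ) ^ 3 - 1)) =
      -(q * (((q : ℚ) ^ (n + 3) - 1) * ((q : ℚ) ^ (n + 2) - 1) /
        (((q : ℚ) ^ 3 - 1) * ((q : ℚ) ^ 2 - 1)))) := by
    rw [gaussBinom_add_two_div_gaussBinom hq n.succ_pos]
    field_simp
    ring
  calc secondLPBound q (n + 3) 3 M
      = -(M ^ 2 * q * (((q : ℚ) ^ n - 1) / ((q : ℚ) ^ (n + 1) - 1))) + 3 * M ^ 2 := by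
        simp only [secondLPBound, Nat.add_sub_cancel, Nat.reduceSubDiff, Nat.cast_ofNat, hbracket]
        field_simp
    _ = -(M * (q * gaussBinom q n 1)) + 3 * M ^ 2 := by
        rw [hM, gaussBinom_one, gaussBinom_one]
        field_simp
    _ = -(M * (M - 1)) + 3 * M ^ 2 := by
        rw [hM, gaussBinom_succ_one hq.ne', add_sub_cancel_right]
    _ = M * (2 * M + 1) := by ring

end GaussianBinomial

section LinearAlgebra

variable {K V W : Type*} [DivisionRing K] [AddCommGroup V] [Module K V] [AddCommGroup W]
  [Module K W]

theorem exists_submodule_finrank_eq {k : ℕ} (hk : k ≤ finrank K V) :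
    ∃ U : Submodule K V, finrank K U = k := by
  obtain ⟨v, hv⟩ := exists_linearIndependent_of_le_finrank hk
  exact ⟨Submodule.span K (Set.range v), by rw [finrank_span_eq_card hv, Fintype.card_fin]⟩

variable [FiniteDimensional K V]

theorem finrank_comap_of_le_range (f : V →ₗ[K] W) {H : Submodule K W}
    (hH : H ≤ LinearMap.range f) :
    finrank K (H.comap f) = finrank K H + finrank K (LinearMap.ker f) := by
  have hker : LinearMap.ker f ≤ H.comap f := f.ker_le_comap
  have h := LinearMap.finrank_range_add_finrank_ker (f.domRestrict (H.comap f))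
  rw [LinearMap.range_domRestrict, Submodule.map_comap_eq_self hH, LinearMap.ker_domRestrict,
    (Submodule.comapSubtypeEquivOfLe hker).finrank_eq] at h
  exact h.symm

theorem finrank_comap_mkQ (U : Submodule K V) (H : Submodule K (V ⧸ U)) :
    finrank K (H.comap U.mkQ) = finrank K H + finrank K U := by
  rw [finrank_comap_of_le_range _ (U.range_mkQ ▸ le_top), U.ker_mkQ]

end LinearAlgebra

theorem sum_sum_add_ite_eq {α : Type*} [DecidableEq α] (s : Finset α) (k : ℕ) :
    ∑ a ∈ s, ∑ b ∈ s, (k + if a = b then 1 else 0) = #s * (k * #s + 1) := by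
  simp only [sum_add_distrib, sum_const, smul_eq_mul, sum_ite_eq, sum_ite_mem, inter_self]
  ring

section Grassmannian

variable {K V : Type*} [Field K] [AddCommGroup V] [Module K V] {k : ℕ}

theorem interDim_self (A : Grass K V k) : interDim A A = k := by
  rw [interDim, inf_idem, A.2]

theorem interDim_le_of_ne {A B : Grass K V (k + 1)} (hAB : A ≠ B) : interDim A B ≤ k := by
  have := Module.finite_of_finrank_eq_succ A.2
  have := Module.finite_of_finrank_eq_succ B.2
  by_contra! hk
  have hA : A.1 ⊓ B.1 = A.1 := Submodule.eq_of_le_of_finrank_le inf_le_left (A.2.trans_le hk)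
  have hB : A.1 ⊓ B.1 = B.1 := Submodule.eq_of_le_of_finrank_le inf_le_right (B.2.trans_le hk)
  exact hAB (Subtype.ext (hA.symm.trans hB))

theorem interDim_le_add_ite [DecidableEq (Grass K V (k + 1))] (A B : Grass K V (k + 1)) :
    interDim A B ≤ k + if A = B then 1 else 0 := by
  split_ifs with hAB
  · exact hAB ▸ (interDim_self A).le
  · exact interDim_le_of_ne hAB

theorem finrank_le_interDim {U : Submodule K V} {A B : Grass K V (k + 1)} (hA : U ≤ A.1)
    (hB : U ≤ B.1) : finrank K U ≤ interDim A B :=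
  have := Module.finite_of_finrank_eq_succ A.2
  Submodule.finrank_mono (le_inf hA hB)

theorem interDim_eq_add_ite [DecidableEq (Grass K V (k + 1))] {U : Submodule K V}
    (hU : finrank K U = k) {A B : Grass K V (k + 1)} (hA : U ≤ A.1) (hB : U ≤ B.1) :
    interDim A B = k + if A = B then 1 else 0 := by
  refine (interDim_le_add_ite A B).antisymm ?_
  split_ifs with hAB
  · exact hAB ▸ (interDim_self A).ge
  · exact hU.ge.trans (finrank_le_interDim hA hB)

theorem totalInter_le (G : Finset (Grass K V (k + 1))) :
    totalInter G ≤ #G * (k * #G + 1) := by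
  classical
  rw [← sum_sum_add_ite_eq]
  exact sum_le_sum fun A _ => sum_le_sum fun B _ => interDim_le_add_ite A B

theorem totalInter_eq_of_forall_le {U : Submodule K V} (hU : finrank K U = k)
    {G : Finset (Grass K V (k + 1))} (hG : ∀ W ∈ G, U ≤ W.1) :
    totalInter G = #G * (k * #G + 1) := by
  classical
  rw [← sum_sum_add_ite_eq]
  exact sum_congr rfl fun A hA => sum_congr rfl fun B hB =>
    interDim_eq_add_ite hU (hG A hA) (hG B hB)

end Grassmannian

section FullStar

variable {K V : Type*} [Field K] [Finite K] [AddCommGroup V] [Module K V]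
  [FiniteDimensional K V] {k : ℕ}

theorem mem_fullStar {U : Submodule K V} {W : Grass K V k} : W ∈ fullStar k U ↔ U ≤ W.1 := by
  simp only [fullStar, mem_filter, mem_univ, true_and]

theorem totalInter_fullStar {U : Submodule K V} (hU : finrank K U = k) :
    totalInter (fullStar (k + 1) U) =
      #(fullStar (k + 1) U) * (k * #(fullStar (k + 1) U) + 1) :=
  totalInter_eq_of_forall_le hU fun _ => mem_fullStar.1

/-- The correspondence theorem for subspaces: the full star at `U` is a Grassmannian of
`V ⧸ U`, which reduces counting its members to counting points when `k = 1`. -/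
noncomputable def grassQuotientEquivFullStar (U : Submodule K V) (k : ℕ) :
    Grass K (V ⧸ U) k ≃ fullStar (finrank K U + k) U where
  toFun H := ⟨⟨H.1.comap U.mkQ, by rw [finrank_comap_mkQ, H.2, add_comm]⟩,
    mem_fullStar.2 (U.le_comap_mkQ H.1)⟩
  invFun W := ⟨W.1.1.map U.mkQ, by
    have h := finrank_comap_mkQ U (W.1.1.map U.mkQ)
    rw [Submodule.comap_map_mkQ, sup_eq_right.2 (mem_fullStar.1 W.2), W.1.2] at h
    lia⟩
  left_inv H := Subtype.ext (Submodule.map_comap_eq_of_surjective U.mkQ_surjective H.1)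
  right_inv W := Subtype.ext <| Subtype.ext <|
    (Submodule.comap_map_mkQ U W.1.1).trans (sup_eq_right.2 (mem_fullStar.1 W.2))

theorem card_grass_one :
    (Fintype.card (Grass K V 1) : ℚ) = gaussBinom (Nat.card K) (finrank K V) 1 := by
  have hpoints : Fintype.card (Grass K V 1) = Nat.card (Projectivization K V) :=
    Nat.card_eq_fintype_card.symm.trans
      (Nat.card_congr (Projectivization.equivSubmodule K V).symm)
  rw [hpoints, Projectivization.card_of_finrank K V rfl,
    gaussBinom_one_eq_geom_sum Finite.one_lt_card.ne']
  push_cast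
  rfl

theorem card_fullStar {U : Submodule K V} (hU : finrank K U = k) :
    (#(fullStar (k + 1) U) : ℚ) = gaussBinom (Nat.card K) (finrank K V - k) 1 := by
  subst hU
  rw [← Fintype.card_coe, ← Fintype.card_congr (grassQuotientEquivFullStar U 1), card_grass_one,
    Submodule.finrank_quotient]

theorem maxTotalInter_eq_totalInter {F G : Finset (Grass K V k)} (hG : #G = #F)
    (hmax : ∀ H : Finset (Grass K V k), #H = #F → totalInter H ≤ totalInter G) :
    maxTotalInter F = totalInter G :=
  (sup'_le _ _ fun H hH => hmax H (mem_powersetCard.1 hH).2).antisymm <|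
    le_sup' totalInter (mem_powersetCard.2 ⟨subset_univ G, hG⟩)

theorem maxTotalInter_eq_totalInter_fullStar {U : Submodule K V} (hU : finrank K U = k)
    {F : Finset (Grass K V (k + 1))} (hF : #(fullStar (k + 1) U) = #F) :
    maxTotalInter F = totalInter (fullStar (k + 1) U) :=
  maxTotalInter_eq_totalInter hF fun H hH => by
    rw [totalInter_fullStar hU, hF, ← hH]
    exact totalInter_le H

theorem card_fullStar_eq_card {U : Submodule K V} (hU : finrank K U = k)
    {F : Finset (Grass K V (k + 1))}
    (hF : (#F : ℚ) = gaussBinom (Nat.card K) (finrank K V - k) 1) :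
    #(fullStar (k + 1) U) = #F := by
  exact_mod_cast (card_fullStar hU).trans hF.symm

theorem maxTotalInter_eq_card_mul (hk : k ≤ finrank K V) {F : Finset (Grass K V (k + 1))}
    (hF : (#F : ℚ) = gaussBinom (Nat.card K) (finrank K V - k) 1) :
    maxTotalInter F = #F * (k * #F + 1) := by
  obtain ⟨U, hU⟩ := exists_submodule_finrank_eq hk
  have hUF := card_fullStar_eq_card hU hF
  rw [maxTotalInter_eq_totalInter_fullStar hU hUF, totalInter_fullStar hU, hUF]

end FullStar

theorem mainTheorem7_general {K V : Type*} [Field K] [Finite K] [AddCommGroup V] [Module K V]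
    [FiniteDimensional K V] (q n : ℕ) (hq : Nat.card K = q) (hV : finrank K V = n)
    (hn : 3 ≤ n) (F : Finset (Grass K V 3)) (hF : (#F : ℚ) = gaussBinom q (n - 2) 1) :
    (maxTotalInter F : ℚ)
        = (2 * (q : ℚ) ^ (n - 2) + q - 3) * ((q : ℚ) ^ (n - 2) - 1) / ((q : ℚ) - 1) ^ 2 ∧
    (∀ U : Submodule K V, finrank K U = 2 →
      #(fullStar 3 U) = #F ∧ totalInter (fullStar 3 U) = maxTotalInter F) ∧
    (#F : ℚ) ≤ gaussBinom q (n - 1) 2 ∧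
    (maxTotalInter F : ℚ) = secondLPBound q n 3 #F := by
  have hq₁ : 1 < q := hq ▸ Finite.one_lt_card
  have hF' : (#F : ℚ) = gaussBinom (Nat.card K) (finrank K V - 2) 1 := by rw [hq, hV, hF]
  have hmax : (maxTotalInter F : ℚ) = #F * (2 * #F + 1) :=
    mod_cast maxTotalInter_eq_card_mul (by lia) hF'
  obtain ⟨m, rfl⟩ := Nat.exists_eq_add_of_le' hn
  refine ⟨?_, fun U hU => ?_, ?_, ?_⟩
  · have hq₂ : (q : ℚ) - 1 ≠ 0 := (sub_pos.2 (Nat.one_lt_cast.2 hq₁)).ne'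
    rw [hmax, hF, gaussBinom_one]
    field_simp
    ring
  · have hUF := card_fullStar_eq_card hU hF'
    exact ⟨hUF, (maxTotalInter_eq_totalInter_fullStar hU hUF).symm⟩
  · exact hF.trans_le (gaussBinom_le_gaussBinom_succ_succ hq₁ m.succ_pos)
  · rw [hmax, hF]
    exact (secondLPBound_three_gaussBinom hq₁ m).symm

theorem mainTheorem7 {K V : Type*} [Field K] [Finite K] [AddCommGroup V] [Module K V]
    [FiniteDimensional K V] (q n : ℕ) (hq : Nat.card K = q) (hV : Module.finrank K V = n)
    (hn : 6 ≤ n) (F : Finset (Grass K V 3)) (hF : (F.card : ℚ) = gaussBinom q (n - 2) 1) :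
    -- the value of the maximum
    (maxTotalInter F : ℚ)
        = (2 * (q : ℚ) ^ (n - 2) + q - 3) * ((q : ℚ) ^ (n - 2) - 1) / ((q : ℚ) - 1) ^ 2 ∧
    -- every full 2-star is a family of the same size that attains it
    (∀ U : Submodule K V, Module.finrank K U = 2 →
      (fullStar 3 U).card = F.card ∧ totalInter (fullStar 3 U) = maxTotalInter F) ∧
    -- the second linear programming bound applies to `F` and holds with equality
    (F.card : ℚ) ≤ gaussBinom q (n - 1) 2 ∧
    (maxTotalInter F : ℚ) = secondLPBound q n 3 F.card := by
  exact mainTheorem7_general q n hq hV (by lia) F hF
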